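/- Consider the damped driven Josephson oscillator $$\frac{dx}{d\tau}=p,\qquad \frac{dp}{d\tau}=-x-\frac{p}{\tilde Q}-\beta\sin\bigl(x+\xi_d\sin(\nu_d\tau)\bigr),$$ with fixed $\beta\ge 0$ and parameters $(1/\tilde Q,\nu_d,\xi_d)\in\mathbb R^3$. A subharmonic of period $2\pi n/\nu_d$, with $n\ge 2$, is a $2\pi n/\nu_d$-periodic solution that is not $2\pi/\nu_d$-periodic. Let $\nu_{\min}>0$, $Q_{\min}>1/2$, and let $\mathcal S_p\subset\mathbb R^3$ be a simply connected open set of parameter values $(1/\tilde Q,\nu_d,\xi_d)$ with $1/\tilde Q>0$, $\tilde Q\ge Q_{\min}$ and $\nu_d\ge\nu_{\min}$; the drive amplitude $\xi_d$ is not restricted, and the damping $1/\tilde Q>0$ may be arbitrarily weak. Let $\bar n\ge 2$ be an integer and $\bar\tau=2\pi\bar n/\nu_{\min}$, and suppose that $$\beta<\frac{0.53}{\bar\tau}\sqrt{1-\frac{1}{4Q_{\min}^2}}.$$ Take, for some parameter setting in $\mathcal S_p$, a (Lyapunov) stable subharmonic of period $2\pi n/\nu_d$ with $2\le n\le\bar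 n$. Then this subharmonic cannot undergo a period-doubling bifurcation when $(1/\tilde Q,\nu_d,\xi_d)$ is varied in $\mathcal S_p$. Precisely, suppose that the parameters are varied along a continuous path in $\mathcal S_p$ and that the solution is followed along this path as a subharmonic of period $2\pi n/\nu_d$ whose initial point at $\tau=0$ depends continuously on the path parameter. Then, at every parameter setting $q\in\mathcal S_p$ so reached, with $z$ the subharmonic obtained there: 1. $-1$ is not an eigenvalue of the linearization at $z(0)$ of the $n$-th power of the Poincaré map, i.e. of the time-$2\pi n/\nu_d$ map of the linearized equations along $z$; and 2. no solutions of twice the period branch off $z$ at $q$: there is a neighbourhood of $(q,z(0))$ that contains no pair $(q',w(0))$ where $w$ is a solution for the parameters $q'=(1/\tilde Q',\nu_d',\xi_d')$ that is $4\pi n/\nu_d'$-periodic but not $2\pi n/\nu_d'$-periodic. -/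

import Mathlib

open Set

namespace JosephsonOscillator

/-- A parameter setting `(1/Q̃, ν_d, ξ_d)`: damping rate, drive frequency, drive amplitude. -/
abbrev Param : Type := ℝ × ℝ × ℝ

/-- The damping rate `1/Q̃`. -/
def Param.damping (q : Param) : ℝ := q.1

/-- The drive frequency `ν_d`. -/
def Param.freq (q : Param) : ℝ := q.2.1

/-- The drive amplitude `ξ_d`. -/
def Param.amp (q : Param) : ℝ := q.2.2

/-- The drive period `2π/ν_d`. -/
noncomputable def Param.period (q : Param) : ℝ := 2 * Real.pi / q.freq

/-- The vector field of `x' = p`, `p' = -x - p/Q̃ - β sin (x + ξ_d sin (ν_d τ))` at time `τ`. -/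
noncomputable def field (β : ℝ) (q : Param) (τ : ℝ) (z : ℝ × ℝ) : ℝ × ℝ :=
  (z.2, -z.1 - q.damping * z.2 - β * Real.sin (z.1 + q.amp * Real.sin (q.freq * τ)))

/-- The curve `z = (x, p) : ℝ → ℝ²` is a (global) solution of the oscillator equations. -/
def IsSolution (β : ℝ) (q : Param) (z : ℝ → ℝ × ℝ) : Prop :=
  ∀ τ : ℝ, HasDerivAt z (field β q τ (z τ)) τ

/-- `z` is a subharmonic of period `2πn/ν_d`: a `2πn/ν_d`-periodic solution with `n ≥ 2` which is
not harmonic, that is, not `2π/ν_d`-periodic. -/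
def IsSubharmonic (β : ℝ) (q : Param) (n : ℕ) (z : ℝ → ℝ × ℝ) : Prop :=
  2 ≤ n ∧ IsSolution β q z ∧ Function.Periodic z (n * q.period) ∧
    ¬ Function.Periodic z q.period

/-- Lyapunov stability (forward in time) of the solution `z`. -/
def IsStable (β : ℝ) (q : Param) (z : ℝ → ℝ × ℝ) : Prop :=
  ∀ ε > 0, ∃ δ > 0, ∀ w : ℝ → ℝ × ℝ, IsSolution β q w → dist (w 0) (z 0) < δ →
    ∀ τ, 0 ≤ τ → dist (w τ) (z τ) < ε

/-- `v` solves the linearization of the oscillator equations along the solution `z = (x, p)`. -/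
def IsVariation (β : ℝ) (q : Param) (z v : ℝ → ℝ × ℝ) : Prop :=
  ∀ τ : ℝ, HasDerivAt v
    ((v τ).2,
      (-1 - β * Real.cos ((z τ).1 + q.amp * Real.sin (q.freq * τ))) * (v τ).1
        - q.damping * (v τ).2) τ

/-- The real number `μ` is an eigenvalue of the linearization at `z 0` of the `n`-th power of the
Poincaré map, i.e. of the time-`2πn/ν_d` map `v 0 ↦ v (2πn/ν_d)` of the linearized equations. -/
def HasMultiplier (β : ℝ) (q : Param) (n : ℕ) (z : ℝ → ℝ × ℝ) (μ : ℝ) : Prop :=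
  ∃ v : ℝ → ℝ × ℝ, IsVariation β q z v ∧ v 0 ≠ 0 ∧ v (n * q.period) = μ • v 0

/-- Solutions of twice the period branch off the `2πn/ν_d`-periodic solution `z` at the parameter
setting `q`: in every neighbourhood of `(q, z 0)` there are a parameter setting `q'` and the initial
point of a solution for `q'` which has period `2 · 2πn/ν_d'` but not `2πn/ν_d'`. No assumption is
made on the side on which, or on the stability with which, the doubled solutions appear. -/
def DoublesPeriod (β : ℝ) (q : Param) (n : ℕ) (z : ℝ → ℝ × ℝ) : Prop :=
  ∀ ε > 0, ∃ (q' : Param) (w : ℝ → ℝ × ℝ), dist q' q < ε ∧ dist (w 0) (z 0) < ε ∧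
    IsSolution β q' w ∧ Function.Periodic w (2 * (n * q'.period)) ∧
      ¬ Function.Periodic w (n * q'.period)

/-- `(q, z)` is obtained from `(q₀, z₀)` by following a `2πn/ν_d`-periodic subharmonic while the
parameters vary along a continuous path `c` in `S`; `Z t` is the subharmonic at the parameters
`c t`, and it depends continuously on `t` through its initial point. -/
def IsContinuation (β : ℝ) (S : Set Param) (n : ℕ) (q₀ : Param) (z₀ : ℝ → ℝ × ℝ)
    (q : Param) (z : ℝ → ℝ × ℝ) : Prop :=
  ∃ (c : ℝ → Param) (Z : ℝ → ℝ → ℝ × ℝ),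
    ContinuousOn c (Icc 0 1) ∧ (∀ t ∈ Icc (0 : ℝ) 1, c t ∈ S) ∧
    ContinuousOn (fun t => Z t 0) (Icc 0 1) ∧
    (∀ t ∈ Icc (0 : ℝ) 1, IsSubharmonic β (c t) n (Z t)) ∧
    c 0 = q₀ ∧ Z 0 = z₀ ∧ c 1 = q ∧ Z 1 = z

end JosephsonOscillator

/-!
Write `γ` for the damping rate, `Ω = √(1 - γ² / 4)`, and `T` for `n` drive periods.  Every
perturbed oscillator `x'' + γ x' + x + g = 0` with `|g| ≤ β |x|` is close to the free one: in the
complex variable `ζ = Ω x + i (x' + γ x / 2)` the free flow is multiplication by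
`exp (-(γ / 2 + i Ω) t)`, and after undoing it Grönwall's inequality shows that the solution moves
by at most `exp (β T / Ω) - 1` times its initial size over the time `T`.  The hypothesis on `β`
gives `β T / Ω < 0.53 < log 2`, so this factor is below `1`.  Hence, if a nonzero
solution satisfies `(x, x') (t + T) = μ (x, x') (t)` for a real `μ`, then `μ cos (Ω T) > 0`
(`mul_cos_pos_of_multiplier`).

Not only the linearized equation is of this form.  For a solution `z` of the nonlinear equation, so
is the equation satisfied by the difference of `z` and its translate by some drive periods, since
the sine is 1-Lipschitz.  A subharmonic of period `T` is not invariant under the translation by one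
drive period, and the difference is a nonzero solution with `μ = 1`; so `cos (Ω T) > 0`
(`IsSubharmonic.cos_pos`): subharmonics occur only near resonance.  A multiplier `-1` of the
linearization, on the other hand, forces `cos (Ω T) < 0`, and so does a solution of period `2 T`
that is not of period `T`, because its difference with its translate by `T` changes sign after the
time `T` (`cos_neg_of_doubled`).  Since `cos (Ω T)` depends continuously on the parameters, a
subharmonic has neither a multiplier `-1` nor solutions of twice the period nearby.
-/

namespace JosephsonOscillator

/-! ### Real multipliers of perturbed damped oscillators -/

/-- A real multiplier `μ` of a small perturbation of a damped oscillator has the sign of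
`cos (Ω T)`.  The perturbation `g` is an arbitrary function, so that this applies both to
linearizations and to differences of two solutions of a nonlinear equation. -/
theorem mul_cos_pos_of_multiplier {γ Ω β T t₀ μ : ℝ} {x p g : ℝ → ℝ}
    (hΩ : 0 < Ω) (hΩγ : Ω ^ 2 = 1 - γ ^ 2 / 4) (hT : 0 < T)
    (hβ : 0 ≤ β) (hβT : β * T < Real.log 2 * Ω)
    (hx : ∀ t, HasDerivAt x (p t) t) (hp : ∀ t, HasDerivAt p (-x t - γ * p t - g t) t)
    (hg : ∀ t, |g t| ≤ β * |x t|) (hne : x t₀ ≠ 0 ∨ p t₀ ≠ 0)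
    (hxT : x (t₀ + T) = μ * x t₀) (hpT : p (t₀ + T) = μ * p t₀) :
    0 < μ * Real.cos (Ω * T) := by
  set ζ : ℝ → ℂ := fun t => ((Ω * x t : ℝ) : ℂ) + ((p t + γ / 2 * x t : ℝ) : ℂ) * Complex.I
    with hζ
  set κ : ℂ := ((γ / 2 : ℝ) : ℂ) + ((Ω : ℝ) : ℂ) * Complex.I with hκ
  set E : ℝ → ℂ := fun t => Complex.exp (((t - t₀ : ℝ) : ℂ) * κ) with hE
  have hζd : ∀ t, HasDerivAt ζ (-κ * ζ t - (g t : ℂ) * Complex.I) t := by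
    intro t
    have h1 : HasDerivAt (fun s => Ω * x s) (Ω * p t) t := (hx t).const_mul Ω
    have h2 : HasDerivAt (fun s => p s + γ / 2 * x s)
        ((-x t - γ * p t - g t) + γ / 2 * p t) t := (hp t).add ((hx t).const_mul _)
    have h3 := h1.ofReal_comp.add (h2.ofReal_comp.mul_const Complex.I)
    refine h3.congr_deriv ?_
    apply Complex.ext
    · simp [hζ, hκ]; ring
    · simp [hζ, hκ]; linear_combination x t * hΩγ
  have hEd : ∀ t, HasDerivAt E (E t * κ) t := by
    intro t
    have h1 : HasDerivAt (fun s : ℝ => ((s - t₀ : ℝ) : ℂ) * κ) (((1 : ℝ) : ℂ) * κ) t :=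
      (((hasDerivAt_id t).sub_const t₀).ofReal_comp).mul_const κ
    exact h1.cexp.congr_deriv (by simp [hE])
  have hyd : ∀ t, HasDerivAt (fun s => E s * ζ s - ζ t₀) (E t * (-(g t : ℂ) * Complex.I)) t := by
    intro t
    refine (((hEd t).mul (hζd t)).sub_const (ζ t₀)).congr_deriv ?_
    ring
  have hgζ : ∀ t, |g t| ≤ β / Ω * ‖ζ t‖ := by
    intro t
    have h1 : Ω * |x t| ≤ ‖ζ t‖ := by
      have := Complex.abs_re_le_norm (ζ t)
      have h2 : (ζ t).re = Ω * x t := by simp [hζ]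
      rwa [h2, abs_mul, abs_of_pos hΩ] at this
    calc |g t| ≤ β * |x t| := hg t
      _ = β / Ω * (Ω * |x t|) := by field_simp
      _ ≤ β / Ω * ‖ζ t‖ := by gcongr
  have hζ0 : 0 < ‖ζ t₀‖ := by
    rw [norm_pos_iff]
    intro h
    have hre := congrArg Complex.re h
    have him := congrArg Complex.im h
    simp [hζ, hΩ.ne'] at hre him
    simp [hre] at him
    rcases hne with h | h
    · exact h hre
    · exact h him
  -- any rate above `β / Ω` will do, as long as the growth over the time `T` is below `2`
  obtain ⟨K, hK1, hK2⟩ : ∃ K, β / Ω < K ∧ K < Real.log 2 / T :=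
    exists_between (by rwa [div_lt_div_iff₀ hΩ hT])
  have hK0 : 0 < K := (div_nonneg hβ hΩ.le).trans_lt hK1
  have hgr := norm_le_gronwallBound_of_norm_deriv_right_le
    (f := fun s => E s * ζ s - ζ t₀) (f' := fun t => E t * (-(g t : ℂ) * Complex.I))
    (δ := 0) (K := K) (ε := K * ‖ζ t₀‖) (a := t₀) (b := t₀ + T)
    (fun t _ => (hyd t).continuousAt.continuousWithinAt)
    (fun t _ => (hyd t).hasDerivWithinAt) (by simp [hE])
    (fun t _ => by
      have h1 : ‖E t * ζ t‖ ≤ ‖E t * ζ t - ζ t₀‖ + ‖ζ t₀‖ := by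
        simpa using norm_add_le (E t * ζ t - ζ t₀) (ζ t₀)
      calc ‖E t * (-(g t : ℂ) * Complex.I)‖ = ‖E t‖ * |g t| := by simp
        _ ≤ ‖E t‖ * (K * ‖ζ t‖) := by
            gcongr
            exact (hgζ t).trans (by gcongr)
        _ = K * ‖E t * ζ t‖ := by rw [norm_mul]; ring
        _ ≤ K * (‖E t * ζ t - ζ t₀‖ + ‖ζ t₀‖) := by gcongr
        _ = K * ‖E t * ζ t - ζ t₀‖ + K * ‖ζ t₀‖ := by ring)
    (t₀ + T) ⟨by linarith, le_rfl⟩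
  rw [gronwallBound_of_K_ne_0 hK0.ne'] at hgr
  have hKT : Real.exp (K * T) < 2 := by
    rw [← Real.lt_log_iff_exp_lt two_pos]
    exact (lt_div_iff₀ hT).mp hK2
  have hζT : ζ (t₀ + T) = (μ : ℂ) * ζ t₀ := by
    simp only [hζ, hxT, hpT]; push_cast; ring
  have hlt : ‖E (t₀ + T) * μ - 1‖ < 1 := by
    have h1 : E (t₀ + T) * ζ (t₀ + T) - ζ t₀ = (E (t₀ + T) * μ - 1) * ζ t₀ := by
      rw [hζT]; ring
    simp only [h1, norm_mul] at hgr
    rw [add_sub_cancel_left] at hgr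
    have h2 : K * ‖ζ t₀‖ / K = ‖ζ t₀‖ := by field_simp
    rw [h2] at hgr
    nlinarith
  have hre : (E (t₀ + T) * μ - 1).re
      = Real.exp (γ / 2 * T) * (μ * Real.cos (Ω * T)) - 1 := by
    have h1 : E (t₀ + T) = ((Real.exp (γ / 2 * T) : ℝ) : ℂ)
        * Complex.exp (((Ω * T : ℝ) : ℂ) * Complex.I) := by
      rw [Complex.ofReal_exp, ← Complex.exp_add]
      simp only [hE, hκ]; congr 1; push_cast; ring
    rw [h1, Complex.exp_mul_I, ← Complex.ofReal_cos, ← Complex.ofReal_sin]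
    simp [-Complex.ofReal_exp, -Complex.ofReal_cos, -Complex.ofReal_sin]
    ring
  have h3 := (abs_lt.mp ((Complex.abs_re_le_norm _).trans_lt hlt)).1
  rw [hre] at h3
  exact pos_of_mul_pos_right (by linarith) (Real.exp_pos _).le

/-! ### Translates by drive periods and variations -/

/-- The angular frequency `√(1 - 1/(4 Q̃²))` of the free damped oscillation. -/
noncomputable def Param.angularFreq (q : Param) : ℝ := Real.sqrt (1 - q.damping ^ 2 / 4)

/-- The parameter `q` is weakly perturbed over `n` drive periods: the drive frequency is positive,
the free oscillator is underdamped, and `β` is small against the inverse of the time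
`n * q.period`. -/
structure WeaklyPerturbed (β : ℝ) (n : ℕ) (q : Param) : Prop where
  freq_pos : 0 < q.freq
  damping_sq_lt : q.damping ^ 2 < 4
  mul_lt : β * (n * q.period) < Real.log 2 * q.angularFreq

namespace WeaklyPerturbed

variable {β : ℝ} {n : ℕ} {q : Param}

theorem angularFreq_pos (hq : WeaklyPerturbed β n q) : 0 < q.angularFreq :=
  Real.sqrt_pos.mpr (by linarith [hq.damping_sq_lt])

theorem angularFreq_sq (hq : WeaklyPerturbed β n q) :
    q.angularFreq ^ 2 = 1 - q.damping ^ 2 / 4 :=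
  Real.sq_sqrt (by linarith [hq.damping_sq_lt])

theorem period_pos (hq : WeaklyPerturbed β n q) : 0 < q.period :=
  div_pos Real.two_pi_pos hq.freq_pos

end WeaklyPerturbed

variable {β : ℝ} {n : ℕ} {q : Param} {z : ℝ → ℝ × ℝ}

theorem hasDerivAt_fst_comp {f : ℝ → ℝ × ℝ} {f' : ℝ × ℝ} {t : ℝ} (h : HasDerivAt f f' t) :
    HasDerivAt (fun r => (f r).1) f'.1 t :=
  (hasFDerivAt_fst (𝕜 := ℝ) (p := f t)).comp_hasDerivAt t h

theorem hasDerivAt_snd_comp {f : ℝ → ℝ × ℝ} {f' : ℝ × ℝ} {t : ℝ} (h : HasDerivAt f f' t) :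
    HasDerivAt (fun r => (f r).2) f'.2 t :=
  (hasFDerivAt_snd (𝕜 := ℝ) (p := f t)).comp_hasDerivAt t h

theorem sin_freq_mul_add_period (hq : q.freq ≠ 0) (m : ℕ) (t : ℝ) :
    Real.sin (q.freq * (t + m * q.period)) = Real.sin (q.freq * t) := by
  have h : q.freq * (t + m * q.period) = q.freq * t + m * (2 * Real.pi) := by
    unfold Param.period; field_simp
  rw [h, Real.sin_add_nat_mul_two_pi]

/-- If the difference of a solution and its translate by `m` drive periods is nonzero at `t₀` and is
multiplied by `μ` over the next `n` drive periods, then `μ` has the sign of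
`cos (Ω n (2π/ν_d))`. -/
theorem IsSolution.mul_cos_pos_of_translate (hq : WeaklyPerturbed β n q) (hβ : 0 ≤ β) (hn : 0 < n)
    (hz : IsSolution β q z) {m : ℕ} {t₀ μ : ℝ} (hne : z (t₀ + m * q.period) ≠ z t₀)
    (hμ : z (t₀ + n * q.period + m * q.period) - z (t₀ + n * q.period)
      = μ • (z (t₀ + m * q.period) - z t₀)) :
    0 < μ * Real.cos (q.angularFreq * (n * q.period)) := by
  set s : ℝ := m * q.period with hs
  have hd : ∀ t, HasDerivAt (fun r => z (r + s) - z r)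
      (field β q (t + s) (z (t + s)) - field β q t (z t)) t := fun t =>
    ((hz (t + s)).comp_add_const t s).sub (hz t)
  refine mul_cos_pos_of_multiplier (t₀ := t₀)
    (x := fun t => (z (t + s) - z t).1) (p := fun t => (z (t + s) - z t).2)
    (g := fun t => β * (Real.sin ((z (t + s)).1 + q.amp * Real.sin (q.freq * t))
      - Real.sin ((z t).1 + q.amp * Real.sin (q.freq * t))))
    hq.angularFreq_pos hq.angularFreq_sq (mul_pos (by exact_mod_cast hn) hq.period_pos) hβ hq.mul_lt
    (fun t => hasDerivAt_fst_comp (hd t))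
    (fun t => (hasDerivAt_snd_comp (hd t)).congr_deriv ?_) (fun t => ?_) ?_ ?_ ?_
  · simp only [field, Prod.snd_sub, Prod.fst_sub, hs, sin_freq_mul_add_period hq.freq_pos.ne']
    ring
  · rw [abs_mul, abs_of_nonneg hβ]
    refine mul_le_mul_of_nonneg_left ((Real.abs_sin_sub_sin_le _ _).trans_eq ?_) hβ
    congr 1
    simp
  · by_contra! h
    exact hne (sub_eq_zero.mp (Prod.ext h.1 h.2))
  · simpa using congrArg Prod.fst hμ
  · simpa using congrArg Prod.snd hμ

/-- Subharmonics occur only near resonance. -/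
theorem IsSubharmonic.cos_pos (hq : WeaklyPerturbed β n q) (hβ : 0 ≤ β)
    (hz : IsSubharmonic β q n z) : 0 < Real.cos (q.angularFreq * (n * q.period)) := by
  obtain ⟨hn, hsol, hper, hnper⟩ := hz
  simp only [Function.Periodic, not_forall] at hnper
  obtain ⟨t₀, ht₀⟩ := hnper
  have h := hsol.mul_cos_pos_of_translate hq hβ (by omega) (m := 1) (t₀ := t₀) (μ := 1)
    (by simpa using ht₀)
    (by rw [add_right_comm, hper, hper, one_smul])
  simpa using h

theorem HasMultiplier.cos_neg (hq : WeaklyPerturbed β n q) (hβ : 0 ≤ β) (hn : 0 < n)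
    (hz : HasMultiplier β q n z (-1)) : Real.cos (q.angularFreq * (n * q.period)) < 0 := by
  obtain ⟨v, hv, hv0, hvT⟩ := hz
  have h := mul_cos_pos_of_multiplier (t₀ := 0) (μ := -1) (x := fun t => (v t).1)
    (p := fun t => (v t).2)
    (g := fun t => β * Real.cos ((z t).1 + q.amp * Real.sin (q.freq * t)) * (v t).1)
    hq.angularFreq_pos hq.angularFreq_sq (mul_pos (by exact_mod_cast hn) hq.period_pos) hβ hq.mul_lt
    (fun t => hasDerivAt_fst_comp (hv t))
    (fun t => (hasDerivAt_snd_comp (hv t)).congr_deriv (by ring)) (fun t => ?_) ?_ ?_ ?_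
  · linarith
  · rw [abs_mul, abs_mul, abs_of_nonneg hβ]
    gcongr
    exact mul_le_of_le_one_right hβ (Real.abs_cos_le_one _)
  · by_contra! h
    exact hv0 (Prod.ext h.1 h.2)
  · simp [hvT]
  · simp [hvT]

theorem cos_neg_of_doubled (hq : WeaklyPerturbed β n q) (hβ : 0 ≤ β) (hn : 0 < n)
    (hz : IsSolution β q z) (hper : Function.Periodic z (2 * (n * q.period)))
    (hnper : ¬ Function.Periodic z (n * q.period)) :
    Real.cos (q.angularFreq * (n * q.period)) < 0 := by
  simp only [Function.Periodic, not_forall] at hnper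
  obtain ⟨t₀, ht₀⟩ := hnper
  have h := hz.mul_cos_pos_of_translate hq hβ hn (m := n) (t₀ := t₀) (μ := -1) ht₀
    (by rw [add_assoc, ← two_mul, hper]; simp)
  linarith

/-- The bound `0.53 / τ̄ * √(1 - 1/(4 Q_min²))` on `β` suffices because `0.53 < log 2`. -/
theorem weaklyPerturbed_of_lt {νmin Qmin : ℝ} {nbar : ℕ} (hνmin : 0 < νmin) (hQmin : 1 / 2 < Qmin)
    (hβ : 0 ≤ β) (hnbar : 0 < nbar) (hn : n ≤ nbar)
    (hcrit : β < 0.53 / (2 * Real.pi * nbar / νmin) * Real.sqrt (1 - 1 / (4 * Qmin ^ 2)))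
    (hdamping : 0 < q.damping) (hQ : Qmin ≤ 1 / q.damping) (hν : νmin ≤ q.freq) :
    WeaklyPerturbed β n q := by
  have hfreq : 0 < q.freq := hνmin.trans_le hν
  have hQ0 : 0 < Qmin := by linarith
  have hγ : q.damping ^ 2 ≤ 1 / Qmin ^ 2 := by
    rw [← one_div_pow]
    exact pow_le_pow_left₀ hdamping.le ((le_one_div hQ0 hdamping).mp hQ) 2
  have hQ2 : 1 / Qmin ^ 2 < 4 := by
    rw [div_lt_iff₀ (by positivity)]; nlinarith
  have hΩ : Real.sqrt (1 - 1 / (4 * Qmin ^ 2)) ≤ q.angularFreq := by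
    apply Real.sqrt_le_sqrt
    have : 1 / (4 * Qmin ^ 2) = 1 / Qmin ^ 2 / 4 := by field_simp
    rw [this]; linarith
  refine ⟨hfreq, hγ.trans_lt hQ2, ?_⟩
  have hΩ0 : 0 < q.angularFreq := Real.sqrt_pos.mpr (by linarith)
  set τ : ℝ := 2 * Real.pi * nbar / νmin with hτ
  have hnb : (0 : ℝ) < nbar := by exact_mod_cast hnbar
  have hτ0 : 0 < τ := by have := Real.pi_pos; positivity
  have hT : n * q.period ≤ τ := by
    have h1 : n * q.period = 2 * Real.pi * n / q.freq := by unfold Param.period; ring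
    rw [h1, hτ]
    have := Real.pi_pos
    have : (n : ℝ) ≤ nbar := by exact_mod_cast hn
    gcongr
  calc β * (n * q.period) ≤ β * τ := by gcongr
    _ < 0.53 / τ * Real.sqrt (1 - 1 / (4 * Qmin ^ 2)) * τ := by gcongr
    _ = 0.53 * Real.sqrt (1 - 1 / (4 * Qmin ^ 2)) := by field_simp
    _ ≤ 0.53 * q.angularFreq := by gcongr
    _ ≤ Real.log 2 * q.angularFreq := by
        gcongr; linarith [Real.log_two_gt_d9]

theorem continuousAt_cos_angularFreq_mul (hq : q.freq ≠ 0) :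
    ContinuousAt (fun r : Param => Real.cos (r.angularFreq * (n * r.period))) q := by
  have h : ContinuousAt Param.period q := by
    refine continuousAt_const.div ?_ hq
    unfold Param.freq; fun_prop
  have h' : Continuous Param.angularFreq := by
    unfold Param.angularFreq Param.damping; fun_prop
  exact Real.continuous_cos.continuousAt.comp
    (h'.continuousAt.mul (continuousAt_const.mul h))

/-- If all parameter settings near `q` are weakly perturbed, then no solutions of twice the period
branch off a subharmonic at `q`; the doubled solutions are excluded near `q` in the whole phase
plane, not only near `z 0`. -/
theorem IsSubharmonic.not_doublesPeriod (hq : ∀ᶠ r in nhds q, WeaklyPerturbed β n r) (hβ : 0 ≤ β)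
    (hz : IsSubharmonic β q n z) : ¬ DoublesPeriod β q n z := by
  intro hdouble
  have hev := (continuousAt_cos_angularFreq_mul (n := n)
    hq.self_of_nhds.freq_pos.ne').eventually_const_lt (hz.cos_pos hq.self_of_nhds hβ)
  obtain ⟨ε, hε, hball⟩ := Metric.eventually_nhds_iff.mp (hq.and hev)
  obtain ⟨q', w, hq', -, hw, hper, hnper⟩ := hdouble ε hε
  obtain ⟨hweak, hpos⟩ := hball hq'
  exact lt_asymm hpos (cos_neg_of_doubled hweak hβ (by have := hz.1; omega) hw hper hnper)

end JosephsonOscillator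

theorem mainTheorem1
    (S : Set JosephsonOscillator.Param) (hSopen : IsOpen S) (hSsc : SimplyConnectedSpace S)
    (νmin Qmin β : ℝ) (hνmin : 0 < νmin) (hQmin : 1 / 2 < Qmin) (hβ : 0 ≤ β)
    (hSdamping : ∀ q ∈ S, 0 < q.damping) (hSQ : ∀ q ∈ S, Qmin ≤ 1 / q.damping)
    (hSν : ∀ q ∈ S, νmin ≤ q.freq)
    (nbar : ℕ) (hnbar : 2 ≤ nbar) (τbar : ℝ) (hτbar : τbar = 2 * Real.pi * nbar / νmin)
    (hcrit : β < 0.53 / τbar * Real.sqrt (1 - 1 / (4 * Qmin ^ 2)))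
    (n : ℕ) (hn : n ≤ nbar)
    (q₀ : JosephsonOscillator.Param) (hq₀ : q₀ ∈ S) (z₀ : ℝ → ℝ × ℝ)
    (hz₀ : JosephsonOscillator.IsSubharmonic β q₀ n z₀)
    (hstable : JosephsonOscillator.IsStable β q₀ z₀)
    (q : JosephsonOscillator.Param) (z : ℝ → ℝ × ℝ)
    (hcont : JosephsonOscillator.IsContinuation β S n q₀ z₀ q z) :
    ¬ JosephsonOscillator.HasMultiplier β q n z (-1) ∧
      ¬ JosephsonOscillator.DoublesPeriod β q n z := by

  subst hτbar
  have hweak : ∀ r ∈ S, JosephsonOscillator.WeaklyPerturbed β n r := fun r hr =>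
    JosephsonOscillator.weaklyPerturbed_of_lt hνmin hQmin hβ (by omega) hn hcrit
      (hSdamping r hr) (hSQ r hr) (hSν r hr)
  obtain ⟨c, Z, -, hcS, -, hZ, -, -, rfl, rfl⟩ := hcont
  have h1 : (1 : ℝ) ∈ Icc (0 : ℝ) 1 := ⟨zero_le_one, le_rfl⟩
  have hsub := hZ 1 h1
  have hmem := hcS 1 h1
  refine ⟨fun hmult => ?_, hsub.not_doublesPeriod ?_ hβ⟩
  · exact lt_asymm (hsub.cos_pos (hweak _ hmem) hβ)
      (hmult.cos_neg (hweak _ hmem) hβ (by have := hsub.1; omega))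
  · filter_upwards [hSopen.mem_nhds hmem] with r hr using hweak r hr
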